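/- There is an absolute constant $C>0$ such that the following holds for every $N\ge 1$. Let $\varrho(x)=\frac1{2\pi}\sqrt{(4-x^2)_+}$ be the semicircle density, and for $k=1,\dots,N$ let $\gamma_k\in(-2,2)$ be defined by $\int_{-2}^{\gamma_k}\varrho(x)\,dx=\frac{k-1/2}{N}$. Let $\sigma>0$, $b>0$, and let $B_{jk}(s)$, $1\le j\ne k\le N$, $0\le s\le\sigma$, be real coefficients, integrable in $s$ on $[0,\sigma]$, symmetric, $B_{jk}(s)=B_{kj}(s)$, and such that $$B_{jk}(s)\ \ge\ \frac{b}{N(\gamma_j-\gamma_k)^2},\qquad j\neq k,\quad 0\le s\le \sigma .$$ Let $(\mathcal B(s)v)_j=\sum_{k\ne j}B_{jk}(s)(v_j-v_k)$ for $v\in\mathbb R^N$, and let $U_{\mathcal B}(0,s)$ be the propagator from time $0$ to time $s$ of the equation $\partial_s v(s)=-\mathcal B(s)v(s)$, that is, for every $u\in\mathbb R^N$ the function $s\mapsto U_{\mathcal B}(0,s)u$ is continuous on $[0,\sigma]$ and $$U_{\mathcal B}(0,s)u=u-\int_0^s\mathcal B(r)\,U_{\mathcal B}(0,r)u\,dr,\qquad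 0\le s\le\sigma .$$ Then for every $u\in\mathbb R^N$ with $\sum_j u_j=0$, $$\|U_{\mathcal B}(0,s)u\|_\infty\ \le\ C\,(sb)^{-3}\,\|u\|_1,\qquad 0<s\le\sigma,$$ where $\|u\|_1=\frac1N\sum_{j=1}^N|u_j|$ and $\|u\|_\infty=\max_j|u_j|$. -/

import Mathlib

open MeasureTheory Set

namespace DiscreteParabolic

/-- The density `ϱ(x) = (2π)⁻¹ √((4 - x²)₊)` of the Wigner semicircle law. -/
noncomputable def semicircleDensity (x : ℝ) : ℝ :=
  (2 * Real.pi)⁻¹ * Real.sqrt (max (4 - x ^ 2) 0)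

/-- The typical locations `γ_1 < ⋯ < γ_N` of the semicircle law: `γ_k` is the quantile of order
`(k - 1/2) / N`.  The index `k : Fin N` starts at `0`, so the order reads `(k + 1/2) / N` here;
`integral_typicalLocation` and `eq_typicalLocation` below are the defining equation and the fact
that it determines `γ_k`. -/
noncomputable def typicalLocation (N : ℕ) (k : Fin N) : ℝ :=
  sInf {x : ℝ | ((k : ℝ) + 1 / 2) / N ≤ ∫ y in (-2 : ℝ)..x, semicircleDensity y}

theorem continuous_semicircleDensity : Continuous semicircleDensity := by
  unfold semicircleDensity
  fun_prop

theorem semicircleDensity_nonneg (x : ℝ) : 0 ≤ semicircleDensity x := by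
  unfold semicircleDensity
  positivity

theorem integral_semicircleDensity : ∫ y in (-2 : ℝ)..2, semicircleDensity y = 1 := by
  have h1 : ∀ y ∈ uIcc (-2 : ℝ) 2,
      semicircleDensity y = (Real.pi)⁻¹ * Real.sqrt (1 - (y / 2) ^ 2) := by
    intro y hy
    rw [uIcc_of_le (by norm_num)] at hy
    have h4 : 0 ≤ 4 - y ^ 2 := by nlinarith [hy.1, hy.2]
    have h5 : 4 - y ^ 2 = 2 ^ 2 * (1 - (y / 2) ^ 2) := by ring
    unfold semicircleDensity
    rw [max_eq_left h4, h5, Real.sqrt_mul (by norm_num), Real.sqrt_sq (by norm_num), mul_inv]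
    ring
  rw [intervalIntegral.integral_congr h1, intervalIntegral.integral_const_mul,
    intervalIntegral.integral_comp_div (fun y => Real.sqrt (1 - y ^ 2)) (by norm_num)]
  have h2 := integral_sqrt_one_sub_sq
  norm_num
  rw [h2]
  field_simp

theorem monotone_integral_semicircleDensity :
    Monotone fun x : ℝ => ∫ y in (-2 : ℝ)..x, semicircleDensity y := by
  intro a b hab
  have h := intervalIntegral.integral_add_adjacent_intervals
    (continuous_semicircleDensity.intervalIntegrable (μ := volume) (-2) a)
    (continuous_semicircleDensity.intervalIntegrable a b)
  have h2 : 0 ≤ ∫ y in a..b, semicircleDensity y :=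
    intervalIntegral.integral_nonneg hab fun y _ => semicircleDensity_nonneg y
  simp only
  linarith

theorem eq_of_integral_semicircleDensity_eq {a b q : ℝ} (hq0 : 0 < q) (hq1 : q < 1)
    (ha : ∫ y in (-2 : ℝ)..a, semicircleDensity y = q)
    (hb : ∫ y in (-2 : ℝ)..b, semicircleDensity y = q) : a = b := by
  wlog hab : a < b generalizing a b
  · rcases lt_trichotomy a b with h | h | h
    · exact this ha hb h
    · exact h
    · exact (this hb ha h).symm
  exfalso
  have ha2 : -2 < a := by
    by_contra! h
    have := monotone_integral_semicircleDensity h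
    simp only [ha, intervalIntegral.integral_same] at this
    linarith
  have hb2 : a < 2 := by
    by_contra! h
    have := monotone_integral_semicircleDensity h
    simp only [ha, integral_semicircleDensity] at this
    linarith
  have h := intervalIntegral.integral_add_adjacent_intervals
    (continuous_semicircleDensity.intervalIntegrable (μ := volume) (-2) a)
    (continuous_semicircleDensity.intervalIntegrable a b)
  have h2 : 0 < ∫ y in a..b, semicircleDensity y := by
    refine intervalIntegral.integral_pos hab continuous_semicircleDensity.continuousOn
      (fun y _ => semicircleDensity_nonneg y) ⟨a, left_mem_Icc.2 hab.le, ?_⟩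
    unfold semicircleDensity
    have : 0 < 4 - a ^ 2 := by nlinarith
    have := lt_max_of_lt_left (c := (0 : ℝ)) this
    positivity
  linarith

theorem order_mem_Ioo {N : ℕ} (k : Fin N) : ((k : ℝ) + 1 / 2) / N ∈ Ioo (0 : ℝ) 1 := by
  have hk : ((k : ℕ) : ℝ) + 1 ≤ N := by exact_mod_cast k.2
  have hk0 : (0 : ℝ) ≤ ((k : ℕ) : ℝ) := Nat.cast_nonneg _
  constructor
  · apply div_pos <;> linarith
  · rw [div_lt_one (by linarith)]
    linarith

theorem integral_typicalLocation (N : ℕ) (k : Fin N) :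
    ∫ y in (-2 : ℝ)..typicalLocation N k, semicircleDensity y = ((k : ℝ) + 1 / 2) / N := by
  obtain ⟨h0, h1⟩ := order_mem_Ioo k
  unfold typicalLocation
  set q : ℝ := ((k : ℝ) + 1 / 2) / N with hq
  have hcont : Continuous fun x : ℝ => ∫ y in (-2 : ℝ)..x, semicircleDensity y :=
    intervalIntegral.continuous_primitive
      (fun a b => continuous_semicircleDensity.intervalIntegrable a b) _
  obtain ⟨x, -, hx⟩ : q ∈ (fun x : ℝ => ∫ y in (-2 : ℝ)..x, semicircleDensity y) '' Icc (-2) 2 := by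
    refine intermediate_value_Icc (by norm_num) hcont.continuousOn ⟨?_, ?_⟩
    · simpa using h0.le
    · simpa [integral_semicircleDensity] using h1.le
  have hleast : IsLeast {x : ℝ | q ≤ ∫ y in (-2 : ℝ)..x, semicircleDensity y} x := by
    refine ⟨hx.ge, fun z hz => ?_⟩
    by_contra! hzx
    have h3 := monotone_integral_semicircleDensity hzx.le
    have h4 : ∫ y in (-2 : ℝ)..z, semicircleDensity y = q := le_antisymm (h3.trans hx.le) hz
    exact hzx.ne (eq_of_integral_semicircleDensity_eq h0 h1 h4 hx)
  rw [hleast.csInf_eq]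
  exact hx

theorem eq_typicalLocation {N : ℕ} {k : Fin N} {x : ℝ}
    (hx : ∫ y in (-2 : ℝ)..x, semicircleDensity y = ((k : ℝ) + 1 / 2) / N) :
    x = typicalLocation N k :=
  eq_of_integral_semicircleDensity_eq (order_mem_Ioo k).1 (order_mem_Ioo k).2 hx
    (integral_typicalLocation N k)

/-- The normalized `ℓ^p` norm `‖u‖_p = (N⁻¹ ∑ i, |u_i|^p)^{1/p}`, `1 ≤ p < ∞`, on `ℝ^N`.
(The norm `‖u‖_∞ = max_i |u_i|` is Mathlib's norm `‖u‖` of `Fin N → ℝ`.) -/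
noncomputable def normalizedNorm {N : ℕ} (p : ℝ) (u : Fin N → ℝ) : ℝ :=
  ((N : ℝ)⁻¹ * ∑ i, |u i| ^ p) ^ (1 / p)

/-- The operator `(𝓑 v)_i = ∑_j B_ij (v_i - v_j)` with coefficients `B_ij`.
The diagonal coefficients play no role. -/
def generator {N : ℕ} (B : Fin N → Fin N → ℝ) (v : Fin N → ℝ) : Fin N → ℝ :=
  fun i => ∑ j, B i j * (v i - v j)

/-- `U t = U_𝓑(s, t)` for `t ∈ [s, T]`: the linear propagator from time `s` of the equation
`∂_t v = -𝓑(t) v`, i.e. `∂_t U_𝓑(s, t) = -𝓑(t) U_𝓑(s, t)` and `U_𝓑(s, s) = I`, where the equation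
is read in integrated form, as is usual for coefficients that are only integrable in time. -/
structure IsPropagator {N : ℕ} (B : ℝ → Fin N → Fin N → ℝ) (s T : ℝ)
    (U : ℝ → (Fin N → ℝ) →ₗ[ℝ] (Fin N → ℝ)) : Prop where
  continuousOn : ∀ u : Fin N → ℝ, ContinuousOn (fun t => U t u) (Icc s T)
  integral_eq : ∀ u : Fin N → ℝ, ∀ t ∈ Icc s T, ∀ i : Fin N,
    U t u i = u i - ∫ r in s..t, generator (B r) (U r u) i

end DiscreteParabolic

namespace DiscreteParabolic

/-! The proof follows the maximum `M(t)` of a solution with `∑ |v_j(0)| ≤ N A` and closes a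
differential inequality for it. The flow preserves the sum and does not increase the `ℓ¹` norm
(`IsSolution.sum_eq`, `IsSolution.sum_abs_le`), so at most `2NA/M` indices carry a value above
`M/2`. Hence many indices near a maximum point carry a value at most `M/2`. As the density vanishes
like a square root at `±2`, `|γ_j - γ_k| ≲ (|j - k|/N)^(2/3)` up to the edge, and the singular
kernel turns these low values into a damping of order `b M^(4/3) A^(-1/3)` (`generator_cube_ge`).
When the high indices are at least half of all, mean zero gives the same bound. Thus `M' ≤ -c b
M^(4/3) A^(-1/3)`, so `M^(-1/3)` grows at least linearly, and `M(T) ≤ C (Tb)^(-3) A` whatever the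
initial maximum (`IsSolution.apply_le`). Applying this to `-v` bounds the minimum. -/

/-! ### Spacing of the typical locations -/

theorem cube_le_integral_semicircleDensity_sq {x y : ℝ} (hx : -2 ≤ x) (hxy : x ≤ y) (hy : y ≤ 2) :
    (y - x) ^ 3 ≤ 540 * (∫ t in x..y, semicircleDensity t) ^ 2 := by
  set d := y - x with hd
  have hd0 : 0 ≤ d := by linarith
  have hint (a b : ℝ) : IntervalIntegrable semicircleDensity volume a b :=
    continuous_semicircleDensity.intervalIntegrable a b
  set c := (2 * Real.pi)⁻¹ * Real.sqrt (2 * d / 3) with hc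
  have hc0 : 0 ≤ c := by positivity
  -- On the middle third both `2 - t` and `2 + t` are at least `d / 3`, and one of them is at least
  -- `2`.
  have h1 : d / 3 * c ≤ ∫ t in (x + d / 3)..(y - d / 3), semicircleDensity t := by
    have h := intervalIntegral.integral_mono_on (a := x + d / 3) (b := y - d / 3) (f := fun _ => c)
      (g := semicircleDensity) (by linarith) (by simp) (hint _ _) (by
        intro t ht
        unfold semicircleDensity
        rw [hc]
        gcongr
        refine le_max_of_le_left ?_
        have h2 : d / 3 ≤ 2 - t := by linarith [ht.2]
        have h3 : d / 3 ≤ 2 + t := by linarith [ht.1]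
        rcases le_total t 0 with h | h <;> nlinarith)
    rw [intervalIntegral.integral_const, smul_eq_mul] at h
    calc d / 3 * c = (y - d / 3 - (x + d / 3)) * c := by rw [hd]; ring
      _ ≤ _ := h
  have h2 : d / 3 * c ≤ ∫ t in x..y, semicircleDensity t := by
    refine h1.trans (intervalIntegral.integral_mono_interval (by linarith) (by linarith)
      (by linarith) (ae_of_all _ semicircleDensity_nonneg) (hint _ _))
  have h3 : (d / 3 * c) ^ 2 ≤ (∫ t in x..y, semicircleDensity t) ^ 2 := by gcongr
  have h4 : (d / 3 * c) ^ 2 = d ^ 3 / (54 * Real.pi ^ 2) := by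
    rw [hc, mul_pow, mul_pow, Real.sq_sqrt (by positivity)]
    field_simp
    ring
  have h5 : Real.pi ^ 2 ≤ 10 := by
    nlinarith [Real.pi_lt_d2, Real.pi_pos]
  have h6 : d ^ 3 ≤ 540 * (d ^ 3 / (54 * Real.pi ^ 2)) := by
    have : 0 < Real.pi := Real.pi_pos
    rw [mul_div_assoc', le_div_iff₀ (by positivity)]
    have : 0 ≤ d ^ 3 := by positivity
    nlinarith
  linarith

theorem typicalLocation_mem_Icc {N : ℕ} (k : Fin N) : typicalLocation N k ∈ Icc (-2 : ℝ) 2 := by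
  obtain ⟨h0, h1⟩ := order_mem_Ioo k
  have h := integral_typicalLocation N k
  constructor
  · by_contra! hk
    have := monotone_integral_semicircleDensity hk.le
    simp only [h, intervalIntegral.integral_same] at this
    linarith
  · by_contra! hk
    have := monotone_integral_semicircleDensity hk.le
    simp only [h, integral_semicircleDensity] at this
    linarith

theorem integral_typicalLocation_typicalLocation {N : ℕ} (j k : Fin N) :
    ∫ t in typicalLocation N j..typicalLocation N k, semicircleDensity t
      = ((k : ℝ) - (j : ℝ)) / N := by
  have h := intervalIntegral.integral_add_adjacent_intervals
    (continuous_semicircleDensity.intervalIntegrable (μ := volume) (-2) (typicalLocation N j))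
    (continuous_semicircleDensity.intervalIntegrable _ (typicalLocation N k))
  rw [integral_typicalLocation, integral_typicalLocation] at h
  have : ∫ t in typicalLocation N j..typicalLocation N k, semicircleDensity t
      = ((k : ℝ) + 1 / 2) / N - ((j : ℝ) + 1 / 2) / N := by linarith
  rw [this]
  ring

theorem typicalLocation_injective (N : ℕ) : Function.Injective (typicalLocation N) := by
  intro j k hjk
  have h := integral_typicalLocation_typicalLocation j k
  have hN : (N : ℝ) ≠ 0 := by
    have := j.pos
    positivity
  rw [hjk, intervalIntegral.integral_same, eq_comm, div_eq_zero_iff, or_iff_left hN] at h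
  exact Fin.ext (by exact_mod_cast (sub_eq_zero.1 h).symm)

theorem abs_typicalLocation_sub_cube_le {N : ℕ} (j k : Fin N) :
    |typicalLocation N j - typicalLocation N k| ^ 3 ≤ 540 * (((j : ℝ) - k) / N) ^ 2 := by
  wlog hjk : typicalLocation N j ≤ typicalLocation N k generalizing j k
  · have h := this k j (le_of_not_ge hjk)
    rw [abs_sub_comm]
    refine h.trans_eq ?_
    ring
  rw [abs_of_nonpos (by linarith), neg_sub]
  refine (cube_le_integral_semicircleDensity_sq (typicalLocation_mem_Icc j).1 hjk
    (typicalLocation_mem_Icc k).2).trans_eq ?_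
  rw [integral_typicalLocation_typicalLocation]
  ring

theorem typicalLocation_sub_sq_le {N : ℕ} (j k : Fin N) :
    (typicalLocation N j - typicalLocation N k) ^ 2 ≤ 16 := by
  have hj := typicalLocation_mem_Icc j
  have hk := typicalLocation_mem_Icc k
  nlinarith [hj.1, hj.2, hk.1, hk.2]

/-- A window of radius `R` in `Fin N` around `i` has at least `R + 1` elements. -/
theorem lt_card_window {N R : ℕ} (i : Fin N) (hR : R < N) :
    R < (Finset.univ.filter fun k : Fin N => (k : ℕ) ≤ i + R ∧ (i : ℕ) ≤ k + R).card := by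
  -- Starting at `min i (N - 1 - R)` shifts the block of `R + 1` indices left when `i` is near the
  -- right end; it still contains `i`.
  have hmem : ∀ r ∈ Finset.range (R + 1), min (i : ℕ) (N - 1 - R) + r < N := by
    intro r hr
    rw [Finset.mem_range] at hr
    omega
  have h := Finset.card_le_card_of_injOn (s := Finset.univ (α := Fin (R + 1)))
    (t := Finset.univ.filter fun k : Fin N => (k : ℕ) ≤ i + R ∧ (i : ℕ) ≤ k + R)
    (fun r => ⟨min (i : ℕ) (N - 1 - R) + r, hmem r (by simp; omega)⟩)
    (by
      intro r _
      have := r.2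
      have := i.2
      simp only [Finset.coe_filter, Finset.mem_univ, true_and, mem_ofPred_eq]
      omega)
    (by
      intro r _ r' _ h
      simp only [Fin.mk.injEq] at h
      exact Fin.ext (by omega))
  simpa using h

/-! ### Bounds for the generator at a fixed time -/

section Generator

variable {N : ℕ} {B : Fin N → Fin N → ℝ} {b : ℝ} {v : Fin N → ℝ}

theorem sum_generator_eq_zero (hsymm : ∀ j k, B j k = B k j) : ∑ j, generator B v j = 0 := by
  have h : ∑ j, generator B v j = -∑ j, generator B v j := by
    conv_lhs => unfold generator; rw [Finset.sum_comm]
    rw [← Finset.sum_neg_distrib]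
    refine Finset.sum_congr rfl fun j _ => ?_
    rw [generator, ← Finset.sum_neg_distrib]
    refine Finset.sum_congr rfl fun k _ => ?_
    rw [hsymm k j]
    ring
  linarith

/-- Symmetrizing in `j, k` leaves terms `B j k * (sign v_j - sign v_k) * (v_j - v_k)`, nonnegative
because the sign is monotone. This is the dissipation of the `ℓ¹` norm. -/
theorem sum_sign_mul_generator_nonneg (hsymm : ∀ j k, B j k = B k j)
    (hB : ∀ j k, j ≠ k → 0 ≤ B j k) :
    0 ≤ ∑ j, (SignType.sign (v j) : ℝ) * generator B v j := by
  have h1 : ∑ j, (SignType.sign (v j) : ℝ) * generator B v j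
      = ∑ j, ∑ k, B j k * ((SignType.sign (v j) : ℝ) * (v j - v k)) := by
    refine Finset.sum_congr rfl fun j _ => ?_
    rw [generator, Finset.mul_sum]
    exact Finset.sum_congr rfl fun k _ => by ring
  have h2 : ∑ j, (SignType.sign (v j) : ℝ) * generator B v j
      = ∑ j, ∑ k, B j k * ((SignType.sign (v k) : ℝ) * (v k - v j)) := by
    rw [h1, Finset.sum_comm]
    exact Finset.sum_congr rfl fun j _ => Finset.sum_congr rfl fun k _ => by rw [hsymm]
  have h3 : 0 ≤ ∑ j, ∑ k, (B j k * ((SignType.sign (v j) : ℝ) * (v j - v k))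
      + B j k * ((SignType.sign (v k) : ℝ) * (v k - v j))) := by
    refine Finset.sum_nonneg fun j _ => Finset.sum_nonneg fun k _ => ?_
    rcases eq_or_ne j k with rfl | hjk
    · simp
    rw [← mul_add]
    refine mul_nonneg (hB j k hjk) ?_
    rcases lt_trichotomy (v j) 0 with h | h | h <;> rcases lt_trichotomy (v k) 0 with h' | h' | h' <;>
      simp [h, h'] <;> linarith
  simp only [Finset.sum_add_distrib] at h3
  linarith

theorem generator_nonneg_of_forall_le (hB : ∀ j k, j ≠ k → 0 ≤ B j k) {i : Fin N}
    (hi : ∀ k, v k ≤ v i) : 0 ≤ generator B v i := by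
  refine Finset.sum_nonneg fun k _ => ?_
  rcases eq_or_ne i k with rfl | hik
  · simp
  exact mul_nonneg (hB i k hik) (sub_nonneg.2 (hi k))

theorem generator_ge_sum (hv : ∀ j k, j ≠ k →
      b / (N * (typicalLocation N j - typicalLocation N k) ^ 2) ≤ B j k)
    {i : Fin N} (hi : ∀ k, v k ≤ v i) :
    ∑ k, b / (N * (typicalLocation N i - typicalLocation N k) ^ 2) * (v i - v k)
      ≤ generator B v i := by
  refine Finset.sum_le_sum fun k _ => ?_
  rcases eq_or_ne i k with rfl | hik
  · simp
  exact mul_le_mul_of_nonneg_right (hv i k hik) (sub_nonneg.2 (hi k))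

/-- Nonlinear lower bound for the generator at a maximum point. -/
theorem generator_cube_ge {A : ℝ} (hb : 0 < b) (hA : 0 < A)
    (hB : ∀ j k, j ≠ k →
      b / (N * (typicalLocation N j - typicalLocation N k) ^ 2) ≤ B j k)
    (hsum : ∑ j, v j = 0) (hnorm : ∑ j, |v j| ≤ N * A)
    {i : Fin N} (hi : ∀ k, v k ≤ v i) (hpos : 0 < v i) :
    b ^ 3 * v i ^ 4 / (74649600 * A) ≤ generator B v i ^ 3 := by
  have hG := generator_ge_sum hB hi
  set G := generator B v i with hGdef
  set M := v i with hM
  have hN : (0 : ℝ) < N := by exact_mod_cast i.pos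
  have hterm (k : Fin N) :
      0 ≤ b / (N * (typicalLocation N i - typicalLocation N k) ^ 2) * (M - v k) := by
    have := hi k
    have : 0 ≤ M - v k := by linarith
    positivity
  classical
  set S := Finset.univ.filter fun k : Fin N => M / 2 < v k with hS
  set n := S.card with hn
  have hn1 : 0 < n := Finset.card_pos.2 ⟨i, by simp [hS, ← hM, hpos]⟩
  -- Markov's inequality for the set `S` of high values.
  have hnM : n * (M / 2) ≤ N * A := by
    calc n * (M / 2) = ∑ k ∈ S, M / 2 := by rw [Finset.sum_const, nsmul_eq_mul]
      _ ≤ ∑ k ∈ S, |v k| := Finset.sum_le_sum fun k hk =>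
          ((Finset.mem_filter.1 hk).2.le).trans (le_abs_self _)
      _ ≤ ∑ k, |v k| := Finset.sum_le_sum_of_subset_of_nonneg (Finset.subset_univ _)
          fun _ _ _ => abs_nonneg _
      _ ≤ N * A := hnorm
  rcases lt_or_ge (2 * n) N with hnN | hnN
  · -- Many indices close to `i` carry a value below `M / 2`.
    set W := Finset.univ.filter fun k : Fin N => (k : ℕ) ≤ i + 2 * n ∧ (i : ℕ) ≤ k + 2 * n with hW
    have hWcard : 2 * n < W.card := lt_card_window i hnN
    have hdiff : n ≤ (W \ S).card := by
      have := Finset.le_card_sdiff S W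
      omega
    set q : ℝ := 2 * n / N with hq
    have hn0 : (0 : ℝ) < n := by exact_mod_cast hn1
    have hq0 : 0 < q := by positivity
    obtain ⟨D, hD0, hD⟩ : ∃ D : ℝ, 0 < D ∧ D ^ 3 = 540 * q ^ 2 :=
      ⟨(540 * q ^ 2) ^ ((1 : ℝ) / 3), by positivity, by
        rw [← Real.rpow_natCast, ← Real.rpow_mul (by positivity)]; norm_num⟩
    have hk : ∀ k ∈ W \ S, b / (N * D ^ 2) * (M / 2) ≤
        b / (N * (typicalLocation N i - typicalLocation N k) ^ 2) * (M - v k) := by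
      intro k hk
      simp only [hW, hS, Finset.mem_sdiff, Finset.mem_filter, Finset.mem_univ, true_and,
        not_lt] at hk
      obtain ⟨⟨h1, h2⟩, h3⟩ := hk
      have hne : typicalLocation N i - typicalLocation N k ≠ 0 := by
        intro h
        have := typicalLocation_injective N (sub_eq_zero.1 h)
        subst this
        linarith
      have hle : |typicalLocation N i - typicalLocation N k| ≤ D := by
        refine le_of_pow_le_pow_left₀ (n := 3) (by norm_num) hD0.le ?_
        rw [hD]
        refine (abs_typicalLocation_sub_cube_le i k).trans ?_
        have h1' : (k : ℝ) ≤ i + 2 * n := by exact_mod_cast h1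
        have h2' : (i : ℝ) ≤ k + 2 * n := by exact_mod_cast h2
        have : |((i : ℝ) - k) / N| ≤ q := by
          rw [abs_div, abs_of_pos hN, hq]
          gcongr
          exact abs_le.2 ⟨by linarith, by linarith⟩
        rw [← sq_abs (((i : ℝ) - k) / N)]
        gcongr
      have hsq : (typicalLocation N i - typicalLocation N k) ^ 2 ≤ D ^ 2 := by
        rw [← sq_abs]
        gcongr
      have : 0 < (typicalLocation N i - typicalLocation N k) ^ 2 := by positivity
      gcongr
      linarith
    -- Since `D ^ 2` is of order `q ^ (4/3)`, this is a bound of order `b * M * q ^ (-1/3)`; cubing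
    -- it avoids fractional powers.
    have hGq : b * q * M / (4 * D ^ 2) ≤ G := by
      calc b * q * M / (4 * D ^ 2) = n * (b / (N * D ^ 2) * (M / 2)) := by
            rw [hq]
            field_simp
            ring
        _ ≤ (W \ S).card * (b / (N * D ^ 2) * (M / 2)) := by
            gcongr
        _ = ∑ k ∈ W \ S, b / (N * D ^ 2) * (M / 2) := by
            rw [Finset.sum_const, nsmul_eq_mul]
        _ ≤ ∑ k ∈ W \ S, b / (N * (typicalLocation N i - typicalLocation N k) ^ 2) * (M - v k) :=
            Finset.sum_le_sum hk
        _ ≤ ∑ k, b / (N * (typicalLocation N i - typicalLocation N k) ^ 2) * (M - v k) :=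
            Finset.sum_le_sum_of_subset_of_nonneg (Finset.subset_univ _) fun k _ _ => hterm k
        _ ≤ G := hG
    have hqA : q * M ≤ 4 * A := by
      rw [hq, div_mul_eq_mul_div, div_le_iff₀ hN]
      linarith
    calc b ^ 3 * M ^ 4 / (74649600 * A) ≤ b ^ 3 * M ^ 3 / (18662400 * q) := by
          rw [div_le_div_iff₀ (by positivity) (by positivity)]
          have : 0 ≤ b ^ 3 * M ^ 3 * 18662400 := by positivity
          nlinarith [mul_le_mul_of_nonneg_left hqA this]
      _ = (b * q * M / (4 * D ^ 2)) ^ 3 := by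
          have : (b * q * M / (4 * D ^ 2)) ^ 3 = b ^ 3 * q ^ 3 * M ^ 3 / (64 * (D ^ 3) ^ 2) := by
            rw [div_pow]
            ring
          rw [this, hD]
          field_simp
          ring
      _ ≤ G ^ 3 := by gcongr
  · -- `M` is comparable to the average of `|v|`; the spectral gap suffices.
    have hGM : b * M / 16 ≤ G := by
      -- Mean zero makes the sum of `M - v k` equal to `N * M`; `16` bounds the squared distances in
      -- `[-2, 2]`.
      calc b * M / 16 = ∑ k, b / (N * 16) * (M - v k) := by
            rw [← Finset.mul_sum, Finset.sum_sub_distrib, hsum, Finset.sum_const, nsmul_eq_mul,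
              Finset.card_univ, Fintype.card_fin]
            field_simp
            ring
        _ ≤ ∑ k, b / (N * (typicalLocation N i - typicalLocation N k) ^ 2) * (M - v k) := by
            refine Finset.sum_le_sum fun k _ => ?_
            rcases eq_or_ne i k with rfl | hik
            · simp [hM]
            have hne : typicalLocation N i - typicalLocation N k ≠ 0 :=
              sub_ne_zero.2 fun h => hik (typicalLocation_injective N h)
            have : 0 < (typicalLocation N i - typicalLocation N k) ^ 2 := by positivity
            have := typicalLocation_sub_sq_le i k
            have : 0 ≤ M - v k := sub_nonneg.2 (hi k)
            gcongr
        _ ≤ G := hG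
    have hMA : M ≤ 4 * A := by
      have : (N : ℝ) ≤ 2 * n := by exact_mod_cast hnN
      have h : N * M ≤ N * (4 * A) := by nlinarith
      exact le_of_mul_le_mul_left h hN
    calc b ^ 3 * M ^ 4 / (74649600 * A) ≤ b ^ 3 * M ^ 3 / 4096 := by
          rw [div_le_div_iff₀ (by positivity) (by positivity)]
          have : 0 ≤ b ^ 3 * M ^ 3 := by positivity
          nlinarith [mul_le_mul_of_nonneg_left hMA this, mul_nonneg this hA.le]
      _ = (b * M / 16) ^ 3 := by ring
      _ ≤ G ^ 3 := by gcongr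

end Generator


/-! ### Calculus for absolutely continuous functions -/

section AbsolutelyContinuous

open AbsolutelyContinuousOnInterval Filter

/-- A function whose increments are controlled by those of finitely many absolutely continuous
functions is absolutely continuous. -/
theorem absolutelyContinuousOnInterval_of_dist_le_sum {ι : Type*} [Fintype ι] {g : ι → ℝ → ℝ}
    {f : ℝ → ℝ} {a b K : ℝ} (hg : ∀ i, AbsolutelyContinuousOnInterval (g i) a b)
    (hf : ∀ x ∈ uIcc a b, ∀ y ∈ uIcc a b, dist (f x) (f y) ≤ K * ∑ i, dist (g i x) (g i y)) :
    AbsolutelyContinuousOnInterval f a b := by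
  have h : Tendsto (fun E : ℕ × (ℕ → ℝ × ℝ) =>
      K * ∑ i, ∑ n ∈ Finset.range E.1, dist (g i (E.2 n).1) (g i (E.2 n).2))
      (totalLengthFilter ⊓ 𝓟 (disjWithin a b)) (nhds 0) := by
    simpa using (tendsto_finsetSum Finset.univ fun i _ => hg i).const_mul K
  refine squeeze_zero' (Eventually.of_forall fun E => Finset.sum_nonneg fun _ _ => dist_nonneg)
    (eventually_inf_principal.2 (Eventually.of_forall fun E hE => ?_)) h
  rw [Finset.sum_comm, Finset.mul_sum]
  exact Finset.sum_le_sum fun n hn => hf _ (hE.1 n hn).1 _ (hE.1 n hn).2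

theorem mul_le_sub_of_le_deriv {f : ℝ → ℝ} {a b L : ℝ} (hab : a ≤ b)
    (hf : AbsolutelyContinuousOnInterval f a b)
    (hL : ∀ᵐ x, x ∈ uIcc a b → L ≤ deriv f x) : L * (b - a) ≤ f b - f a := by
  rw [← hf.integral_deriv_eq_sub]
  have h : ∫ _ in a..b, L = L * (b - a) := by
    rw [intervalIntegral.integral_const, smul_eq_mul, mul_comm]
  rw [← h]
  refine intervalIntegral.integral_mono_ae_restrict hab (by simp) hf.intervalIntegrable_deriv ?_
  rw [EventuallyLE, ae_restrict_iff' measurableSet_Icc, ← uIcc_of_le hab]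
  exact hL

/-- At a zero of `f`, `|f|` has a minimum, so `deriv` is `0` there, differentiable or not, in
agreement with `sign 0 = 0`. -/
theorem deriv_abs_comp {f : ℝ → ℝ} {x f₁ : ℝ} (hf : HasDerivAt f f₁ x) :
    deriv (fun y => |f y|) x = SignType.sign (f x) * f₁ := by
  rcases eq_or_ne (f x) 0 with h | h
  · have : IsLocalMin (fun y => |f y|) x := by
      refine Eventually.of_forall fun y => ?_
      simp [h]
    rw [this.deriv_eq_zero, h]
    simp
  · exact ((hasDerivAt_abs h).comp x hf).deriv

end AbsolutelyContinuous

/-- An absolutely continuous solution of `∂_t v = -𝓑(t) v` on `[0, T]`. -/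
structure IsSolution {N : ℕ} (B : ℝ → Fin N → Fin N → ℝ) (T : ℝ) (v : ℝ → Fin N → ℝ) : Prop where
  absolutelyContinuous : ∀ i, AbsolutelyContinuousOnInterval (fun t => v t i) 0 T
  hasDerivAt : ∀ i, ∀ᵐ t, t ∈ uIcc 0 T → HasDerivAt (fun t => v t i) (-generator (B t) (v t) i) t

/-! ### Conservation of the sum and `ℓ¹` contraction -/

section Solution

variable {N : ℕ} {B : ℝ → Fin N → Fin N → ℝ} {T : ℝ} {v : ℝ → Fin N → ℝ}

theorem IsPropagator.isSolution {U : ℝ → (Fin N → ℝ) →ₗ[ℝ] (Fin N → ℝ)} (hT : 0 ≤ T)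
    (hint : ∀ j k, j ≠ k → IntervalIntegrable (fun s => B s j k) volume 0 T)
    (hU : IsPropagator B 0 T U) (u : Fin N → ℝ) : IsSolution B T fun t => U t u := by
  have hcont (i : Fin N) : ContinuousOn (fun t => U t u i) (uIcc 0 T) := by
    rw [uIcc_of_le hT]
    exact (continuous_apply i).comp_continuousOn (hU.continuousOn u)
  have hg (i : Fin N) :
      IntervalIntegrable (fun r => generator (B r) (U r u) i) volume 0 T := by
    unfold generator
    have h : ∀ j ∈ Finset.univ, IntervalIntegrable
        (fun r => B r i j * (U r u i - U r u j)) volume 0 T := fun j _ => ?_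
    · simpa only [Finset.sum_fn] using IntervalIntegrable.sum Finset.univ h
    rcases eq_or_ne i j with rfl | hij
    · simp
    · exact (hint i j hij).mul_continuousOn ((hcont i).sub (hcont j))
  have hlocal (i : Fin N) : ∀ t ∈ uIcc 0 T,
      U t u i = u i - ∫ r in (0 : ℝ)..t, generator (B r) (U r u) i := by
    rw [uIcc_of_le hT]
    exact fun t ht => hU.integral_eq u t ht i
  refine ⟨fun i => ?_, fun i => ?_⟩
  · refine absolutelyContinuousOnInterval_of_dist_le_sum (K := 1) (ι := Unit)
      (fun _ => (hg i).absolutelyContinuousOnInterval_intervalIntegral left_mem_uIcc) ?_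
    intro x hx y hy
    rw [hlocal i x hx, hlocal i y hy]
    simp only [dist_sub_left, Finset.univ_unique, Finset.sum_singleton, one_mul, le_refl]
  · have h0 : ∀ᵐ t : ℝ, t ≠ 0 := by simp [ae_iff]
    have h1 : ∀ᵐ t : ℝ, t ≠ T := by simp [ae_iff]
    filter_upwards [(hg i).ae_hasDerivAt_integral, h0, h1] with t ht ht0 htT htmem
    have hd := (ht htmem 0 left_mem_uIcc).const_sub (u i)
    refine hd.congr_of_eventuallyEq ?_
    rw [uIcc_of_le hT] at htmem
    have : Icc 0 T ∈ nhds t :=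
      Icc_mem_nhds (lt_of_le_of_ne htmem.1 ht0.symm) (lt_of_le_of_ne htmem.2 htT)
    filter_upwards [this] with y hy
    exact hlocal i y (by rwa [uIcc_of_le hT])

theorem IsSolution.mono (hv : IsSolution B T v) {S : ℝ} (hS : 0 ≤ S) (hST : S ≤ T) :
    IsSolution B S v := by
  have hsub : uIcc 0 S ⊆ uIcc 0 T := by
    rw [uIcc_of_le hS, uIcc_of_le (hS.trans hST)]
    exact Icc_subset_Icc_right hST
  exact ⟨fun i => (hv.absolutelyContinuous i).mono hsub,
    fun i => (hv.hasDerivAt i).mono fun t ht h => ht (hsub h)⟩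

theorem IsSolution.neg (hv : IsSolution B T v) : IsSolution B T fun t => -v t := by
  refine ⟨fun i => (hv.absolutelyContinuous i).neg, fun i => (hv.hasDerivAt i).mono fun t ht h => ?_⟩
  have := (ht h).neg
  convert! this using 1
  simp only [generator, Pi.neg_apply, ← Finset.sum_neg_distrib]
  exact Finset.sum_congr rfl fun k _ => by ring

theorem IsSolution.ae_hasDerivAt (hv : IsSolution B T v) :
    ∀ᵐ t, t ∈ uIcc 0 T → ∀ i, HasDerivAt (fun t => v t i) (-generator (B t) (v t) i) t := by
  filter_upwards [ae_all_iff.2 hv.hasDerivAt] with t ht h i using ht i h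

theorem IsSolution.sum_eq (hv : IsSolution B T v) (hT : 0 ≤ T)
    (hsymm : ∀ s ∈ Icc 0 T, ∀ j k, B s j k = B s k j) : ∑ i, v T i = ∑ i, v 0 i := by
  have hac : AbsolutelyContinuousOnInterval (fun t => ∑ i, v t i) 0 T := by
    refine absolutelyContinuousOnInterval_of_dist_le_sum (K := 1) hv.absolutelyContinuous ?_
    intro x _ y _
    rw [one_mul]
    exact dist_sum_sum_le _ _ _
  have h0 : ∀ᵐ t, t ∈ uIcc 0 T → HasDerivAt (fun t => ∑ i, v t i) 0 t := by
    filter_upwards [hv.ae_hasDerivAt] with t ht h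
    have hd := HasDerivAt.fun_sum (u := Finset.univ) fun i _ => ht h i
    rw [uIcc_of_le hT] at h
    rwa [Finset.sum_neg_distrib, sum_generator_eq_zero (hsymm t h), neg_zero] at hd
  obtain ⟨C, hC⟩ := hac.const_of_ae_hasDerivAt_zero h0
  exact (hC T right_mem_uIcc).trans (hC 0 left_mem_uIcc).symm

theorem IsSolution.sum_abs_le (hv : IsSolution B T v) (hT : 0 ≤ T)
    (hsymm : ∀ s ∈ Icc 0 T, ∀ j k, B s j k = B s k j)
    (hB : ∀ s ∈ Icc 0 T, ∀ j k, j ≠ k → 0 ≤ B s j k) : ∑ i, |v T i| ≤ ∑ i, |v 0 i| := by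
  have habs (i : Fin N) : AbsolutelyContinuousOnInterval (fun t => |v t i|) 0 T := by
    refine absolutelyContinuousOnInterval_of_dist_le_sum (K := 1) (ι := Unit)
      (fun _ => hv.absolutelyContinuous i) ?_
    intro x _ y _
    simpa [Real.dist_eq] using abs_abs_sub_abs_le_abs_sub (v x i) (v y i)
  have hac : AbsolutelyContinuousOnInterval (fun t => -∑ i, |v t i|) 0 T := by
    refine absolutelyContinuousOnInterval_of_dist_le_sum (K := 1) habs ?_
    intro x _ y _
    rw [one_mul, dist_neg_neg]
    exact dist_sum_sum_le _ _ _
  have hdiff := ae_all_iff.2 fun i => (habs i).ae_differentiableAt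
  have h := mul_le_sub_of_le_deriv (L := 0) hT hac (by
    filter_upwards [hv.ae_hasDerivAt, hdiff] with t ht hd h
    have hsum := HasDerivAt.fun_sum (u := Finset.univ) fun i _ => (hd i h).hasDerivAt
    rw [hsum.fun_neg.deriv, ← Finset.sum_neg_distrib]
    rw [uIcc_of_le hT] at h
    refine (sum_sign_mul_generator_nonneg (v := v t) (hsymm t h) (hB t h)).trans_eq ?_
    refine Finset.sum_congr rfl fun i _ => ?_
    rw [uIcc_of_le hT] at ht hd
    rw [deriv_abs_comp (ht h i)]
    ring)
  simp only [zero_mul] at h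
  linarith

end Solution

/-! ### Decay of the maximum -/

section Maximum

variable {N : ℕ} {B : ℝ → Fin N → Fin N → ℝ} {T b A : ℝ} {v : ℝ → Fin N → ℝ}

theorem IsSolution.apply_le (hv : IsSolution B T v) (hT : 0 < T) (hb : 0 < b) (hA : 0 < A)
    (hsymm : ∀ s ∈ Icc 0 T, ∀ j k, B s j k = B s k j)
    (hB : ∀ s ∈ Icc 0 T, ∀ j k, j ≠ k →
      b / (N * (typicalLocation N j - typicalLocation N k) ^ 2) ≤ B s j k)
    (hsum : ∑ j, v 0 j = 0) (hnorm : ∑ j, |v 0 j| ≤ N * A) (i : Fin N) :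
    v T i ≤ 2015539200 * (T * b) ^ (-3 : ℤ) * A := by
  have : Nonempty (Fin N) := ⟨i⟩
  have hB0 : ∀ s ∈ Icc 0 T, ∀ j k, j ≠ k → 0 ≤ B s j k := fun s hs j k hjk =>
    le_trans (by positivity) (hB s hs j k hjk)
  set M : ℝ → ℝ := fun t => Finset.univ.sup' Finset.univ_nonempty (v t) with hM
  have hle (t : ℝ) (j : Fin N) : v t j ≤ M t := Finset.le_sup' (v t) (Finset.mem_univ j)
  have hmax (t : ℝ) : ∃ j, v t j = M t := by
    obtain ⟨j, -, hj⟩ := Finset.exists_mem_eq_sup' Finset.univ_nonempty (v t)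
    exact ⟨j, hj.symm⟩
  refine (hle T i).trans ?_
  rcases le_or_gt (M T) 0 with hMT | hMT
  · exact hMT.trans (by positivity)
  have hMlip (x y : ℝ) : dist (M x) (M y) ≤ ∑ j, dist (v x j) (v y j) := by
    have key (x y : ℝ) : M x - M y ≤ ∑ j, dist (v x j) (v y j) := by
      obtain ⟨j, hj⟩ := hmax x
      calc M x - M y ≤ v x j - v y j := by rw [hj]; linarith [hle y j]
        _ ≤ dist (v x j) (v y j) := le_abs_self _
        _ ≤ _ := Finset.single_le_sum (f := fun j => dist (v x j) (v y j))
          (fun _ _ => dist_nonneg) (Finset.mem_univ j)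
    rw [Real.dist_eq]
    refine abs_le.2 ⟨?_, key x y⟩
    have := key y x
    simp only [dist_comm (v y _)] at this
    linarith
  have hMac : AbsolutelyContinuousOnInterval M 0 T :=
    absolutelyContinuousOnInterval_of_dist_le_sum (K := 1) hv.absolutelyContinuous
      fun x _ y _ => by rw [one_mul]; exact hMlip x y
  have hMderiv : ∀ᵐ t, t ∈ uIcc 0 T → ∃ G, HasDerivAt M (-G) t ∧ 0 ≤ G ∧
      (0 < M t → b ^ 3 * M t ^ 4 / (74649600 * A) ≤ G ^ 3) := by
    filter_upwards [hv.ae_hasDerivAt, hMac.ae_differentiableAt] with t ht hdiff hmem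
    obtain ⟨j, hj⟩ := hmax t
    have hd := (hdiff hmem).hasDerivAt
    -- `M - v_j` is nonnegative and vanishes at `t`, so where both are differentiable `M' = v_j'`
    -- for any maximizing `j`.
    have hloc : IsLocalMin (fun y => M y - v y j) t := by
      refine Filter.Eventually.of_forall fun y => ?_
      simp only [hj, sub_self]
      exact sub_nonneg.2 (hle y j)
    have heq := hloc.hasDerivAt_eq_zero (hd.sub (ht hmem j))
    rw [uIcc_of_le hT.le] at hmem
    have hsub : ∀ s ∈ Icc 0 t, s ∈ Icc 0 T := fun s hs => ⟨hs.1, hs.2.trans hmem.2⟩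
    have hvt := hv.mono hmem.1 hmem.2
    have hj' : ∀ k, v t k ≤ v t j := fun k => by rw [hj]; exact hle t k
    refine ⟨generator (B t) (v t) j, ?_, generator_nonneg_of_forall_le (hB0 t hmem) hj', ?_⟩
    · rwa [← sub_eq_zero.1 heq]
    · intro hpos
      rw [← hj]
      exact generator_cube_ge hb hA (hB t hmem)
        ((hvt.sum_eq hmem.1 fun s hs => hsymm s (hsub s hs)).trans hsum)
        ((hvt.sum_abs_le hmem.1 (fun s hs => hsymm s (hsub s hs))
          fun s hs => hB0 s (hsub s hs)).trans hnorm) hj' (by rwa [hj])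
  have hMge : ∀ t ∈ uIcc 0 T, M T ≤ M t := by
    intro t ht
    have ht' := ht
    rw [uIcc_of_le hT.le] at ht'
    have hsub : uIcc t T ⊆ uIcc 0 T := uIcc_subset_uIcc ht right_mem_uIcc
    have h := mul_le_sub_of_le_deriv (L := 0) ht'.2 (hMac.mono hsub).neg (by
      filter_upwards [hMderiv] with s hs hmem
      obtain ⟨G, hG, hG0, -⟩ := hs (hsub hmem)
      rw [hG.neg.deriv]
      simpa using hG0)
    simp only [zero_mul, Pi.neg_apply] at h
    linarith
  have hMpos : ∀ t ∈ uIcc 0 T, 0 < M t := fun t ht => hMT.trans_le (hMge t ht)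
  -- `2015539200 = 27 * 74649600`; the `27` cubes the factor `1/3` from differentiating `M ^
  -- (-1/3)`.
  obtain ⟨L, hL0, hL⟩ : ∃ L : ℝ, 0 < L ∧ L ^ 3 = b ^ 3 / (2015539200 * A) :=
    ⟨(b ^ 3 / (2015539200 * A)) ^ ((1 : ℝ) / 3), by positivity, by
      rw [← Real.rpow_natCast, ← Real.rpow_mul (by positivity)]; norm_num⟩
  set h : ℝ → ℝ := fun t => M t ^ (-(1 / 3) : ℝ) with hh
  -- `M` stays between `M T > 0` and a finite bound, where the power is Lipschitz.
  have hhac : AbsolutelyContinuousOnInterval h 0 T := by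
    obtain ⟨R, hR⟩ := hMac.exists_bound
    have hcd : ContDiffOn ℝ 1 (fun x : ℝ => x ^ (-(1 / 3) : ℝ)) (Icc (M T) R) := fun x hx =>
      (Real.contDiffAt_rpow_const_of_ne (hMT.trans_le hx.1).ne').contDiffWithinAt
    obtain ⟨K, hK⟩ := hcd.exists_lipschitzOnWith (by decide) (convex_Icc _ _) isCompact_Icc
    have hmem : ∀ t ∈ uIcc 0 T, M t ∈ Icc (M T) R := fun t ht =>
      ⟨hMge t ht, (le_abs_self _).trans (hR t ht)⟩
    refine absolutelyContinuousOnInterval_of_dist_le_sum (K := K) (ι := Unit) (fun _ => hMac) ?_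
    intro x hx y hy
    simpa [hh] using hK.dist_le_mul _ (hmem x hx) _ (hmem y hy)
  have hgrowth := mul_le_sub_of_le_deriv (L := L) hT.le hhac (by
    filter_upwards [hMderiv] with t ht hmem
    obtain ⟨G, hG, hG0, hG3⟩ := ht hmem
    have hpos := hMpos t hmem
    rw [(hG.rpow_const (Or.inl hpos.ne')).deriv]
    refine le_of_pow_le_pow_left₀ (n := 3) (by norm_num) ?_ ?_
    · have : 0 ≤ M t ^ (-(1 / 3) - 1 : ℝ) := by positivity
      nlinarith [mul_nonneg hG0 this]
    have hpow : (M t ^ (-(1 / 3) - 1 : ℝ)) ^ 3 = (M t ^ 4)⁻¹ := by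
      rw [← Real.rpow_natCast (M t ^ _), ← Real.rpow_mul hpos.le, ← Real.rpow_natCast (M t),
        ← Real.rpow_neg hpos.le]
      norm_num
    calc L ^ 3 = b ^ 3 * M t ^ 4 / (74649600 * A) * (M t ^ 4)⁻¹ / 27 := by
          rw [hL]
          field_simp
          norm_num
      _ ≤ G ^ 3 * (M t ^ 4)⁻¹ / 27 := by
          have := hG3 hpos
          gcongr
      _ = _ := by
          rw [mul_pow, hpow]
          ring)
  have h0 : 0 ≤ h 0 := Real.rpow_nonneg (hMpos 0 left_mem_uIcc).le _
  have hcube : (L * T) ^ 3 ≤ (M T)⁻¹ := by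
    have h3 : h T ^ 3 = (M T)⁻¹ := by
      rw [hh, ← Real.rpow_natCast, ← Real.rpow_mul hMT.le, ← Real.rpow_neg_one]
      norm_num
    rw [← h3]
    have : L * T ≤ h T := by linarith
    gcongr
  rw [mul_pow, hL, le_inv_comm₀ (by positivity) hMT] at hcube
  refine hcube.trans_eq ?_
  rw [show (-3 : ℤ) = -((3 : ℕ) : ℤ) by norm_num, zpow_neg, zpow_natCast]
  field_simp

end Maximum

theorem mul_normalizedNorm_one {N : ℕ} (hN : N ≠ 0) (u : Fin N → ℝ) :
    N * normalizedNorm 1 u = ∑ i, |u i| := by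
  have : (N : ℝ) ≠ 0 := by exact_mod_cast hN
  simp only [normalizedNorm, Real.rpow_one, div_one]
  field_simp

end DiscreteParabolic

theorem proposition3p5 :
    ∃ C : ℝ, 0 < C ∧
      ∀ (N : ℕ) (σ b : ℝ) (B : ℝ → Fin N → Fin N → ℝ)
        (U : ℝ → (Fin N → ℝ) →ₗ[ℝ] (Fin N → ℝ)),
        0 < b →
        (∀ j k, j ≠ k → IntervalIntegrable (fun s => B s j k) MeasureTheory.volume 0 σ) →
        (∀ s ∈ Set.Icc 0 σ, ∀ j k, B s j k = B s k j) →
        (∀ s ∈ Set.Icc 0 σ, ∀ j k, j ≠ k →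
          b / (N * (DiscreteParabolic.typicalLocation N j -
            DiscreteParabolic.typicalLocation N k) ^ 2) ≤ B s j k) →
        DiscreteParabolic.IsPropagator B 0 σ U →
        ∀ u : Fin N → ℝ, ∑ j, u j = 0 →
          ∀ s ∈ Set.Ioc 0 σ,
            ‖U s u‖ ≤ C * (s * b) ^ (-3 : ℤ) * DiscreteParabolic.normalizedNorm 1 u := by
  open DiscreteParabolic in
  refine ⟨2015539200, by norm_num, ?_⟩
  intro N σ b B U hb hint hsymm hB hU u hu s hs
  have hs0 : 0 < s := hs.1
  have hA0 : 0 ≤ normalizedNorm 1 u := by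
    unfold normalizedNorm
    positivity
  have hσ : 0 ≤ σ := hs0.le.trans hs.2
  rcases eq_or_ne N 0 with rfl | hN
  · rw [Subsingleton.elim (U s u) 0, norm_zero]
    positivity
  have hnorm := mul_normalizedNorm_one hN u
  -- `IsSolution.apply_le` needs `A > 0`; a zero norm forces `u = 0`.
  rcases hA0.eq_or_lt with hA | hA
  · rw [← hA, mul_zero, eq_comm, Finset.sum_eq_zero_iff_of_nonneg fun _ _ => abs_nonneg _] at hnorm
    have : u = 0 := funext fun i => abs_eq_zero.1 (hnorm i (Finset.mem_univ i))
    rw [this, map_zero, norm_zero]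
    rw [this] at hA
    rw [← hA, mul_zero]
  have hU0 : U 0 u = u := by
    funext i
    simpa using hU.integral_eq u 0 (left_mem_Icc.2 hσ) i
  have hsol := (hU.isSolution hσ hint u).mono hs0.le hs.2
  have hsub : ∀ r ∈ Icc 0 s, r ∈ Icc 0 σ := fun r hr => ⟨hr.1, hr.2.trans hs.2⟩
  have hupper := hsol.apply_le hs0 hb hA (fun r hr => hsymm r (hsub r hr))
    (fun r hr => hB r (hsub r hr)) (by rw [hU0, hu]) (by rw [hU0, hnorm])
  have hlower := hsol.neg.apply_le hs0 hb hA (fun r hr => hsymm r (hsub r hr))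
    (fun r hr => hB r (hsub r hr)) (by simp [hU0, hu]) (by simp [hU0, hnorm])
  refine (pi_norm_le_iff_of_nonneg (by positivity)).2 fun i => abs_le.2 ⟨?_, hupper i⟩
  have := hlower i
  rw [Pi.neg_apply] at this
  linarith
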